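/- Let $G$ be a group. An N-series of $G$ is a descending chain of subgroups $G = N_1 \geq N_2 \geq N_3 \geq \cdots$ such that $[N_i,N_j] \subset N_{i+j}$ for all $i,j\geq 1$. For a commutative ring $R$ and $i \geq 1$, let $\Delta_i(N;R)$ be the $R$-submodule of the group ring $R[G]$ spanned by all products $(g_1-1)\cdots(g_r-1)$ with $g_1\in N_{k_1},\dots,g_r\in N_{k_r}$ for some integers $k_1,\dots,k_r\geq 1$ with $k_1+\cdots+k_r\geq i$. The $i$-th dimension subgroup of $G$ defined by $N$ with coefficients in $R$ is $D_i(N;R) := G\cap(1+\Delta_i(N;R)) = \{g \in G : g - 1 \in \Delta_i(N;R)\}$, which is a subgroup of $G$. **Theorem.** Let $G$ be a group, let $N=(N_i)_{i\geq 1}$ be an N-series of $G$ and let $\mathbb{F}$ be a field of characteristic zero. Then, for all $i\geq 1$, $$D_i(N;\mathbb{F}) = \sqrt{N_i},$$ where $\sqrt{N_i} := \{g\in G : g^m\in N_i \text{ for some integer } m\geq 1\}$ is the isolator of $N_i$. -/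

import Mathlib

/-- An N-series of a group `G`: a descending chain `G = N 1 ≥ N 2 ≥ N 3 ≥ ⋯` of subgroups
such that `[N i, N j] ⊆ N (i + j)` for all `i, j ≥ 1`. -/
structure NSeries (G : Type*) [Group G] where
  /-- The `i`-th term, for `i ≥ 1`. -/
  term : ℕ+ → Subgroup G
  term_one : term 1 = ⊤
  antitone_term : Antitone term
  commutator_le : ∀ i j : ℕ+, ⁅term i, term j⁆ ≤ term (i + j)

namespace NSeries

/-- The `i`-th term of the filtration of the group ring `R[G]` induced by an N-series `N`:
the `R`-linear span of all products `(g₁ - 1) ⋯ (gᵣ - 1)` with `g₁ ∈ N k₁, …, gᵣ ∈ N kᵣ` and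
`k₁ + ⋯ + kᵣ ≥ i`. The list `l` is `[(k₁, g₁), …, (kᵣ, gᵣ)]`; it is nonempty since `i ≥ 1`. -/
noncomputable def groupRingFiltration {G : Type*} [Group G] (N : NSeries G)
    (R : Type*) [CommRing R] (i : ℕ+) : Submodule R (MonoidAlgebra R G) :=
  Submodule.span R {x | ∃ l : List (ℕ+ × G), (∀ p ∈ l, p.2 ∈ N.term p.1) ∧
    (i : ℕ) ≤ (l.map fun p => (p.1 : ℕ)).sum ∧
    x = (l.map fun p => MonoidAlgebra.of R G p.2 - 1).prod}

theorem mul_of_mem_groupRingFiltration {G : Type*} [Group G] (N : NSeries G)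
    (R : Type*) [CommRing R] (i : ℕ+) (h : G) {x : MonoidAlgebra R G}
    (hx : x ∈ N.groupRingFiltration R i) :
    x * MonoidAlgebra.of R G h ∈ N.groupRingFiltration R i := by
  unfold groupRingFiltration at hx ⊢
  induction hx using Submodule.span_induction with
  | mem x hx =>
    obtain ⟨l, hl, hi, rfl⟩ := hx
    have key : ((l.map fun p => MonoidAlgebra.of R G p.2 - 1).prod) * MonoidAlgebra.of R G h
        = (l.map fun p => MonoidAlgebra.of R G p.2 - 1).prod
          + ((l ++ [((1 : ℕ+), h)]).map fun p => MonoidAlgebra.of R G p.2 - 1).prod := by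
      rw [List.map_append, List.prod_append, List.map_singleton, List.prod_singleton,
        mul_sub, mul_one, add_sub_cancel]
    rw [key]
    refine Submodule.add_mem _ (Submodule.subset_span ⟨l, hl, hi, rfl⟩)
      (Submodule.subset_span ⟨_, ?_, ?_, rfl⟩)
    · intro p hp
      rcases List.mem_append.1 hp with hp | hp
      · exact hl p hp
      · rw [List.mem_singleton.1 hp, N.term_one]
        exact Subgroup.mem_top _
    · rw [List.map_append, List.sum_append]
      exact le_add_right hi
  | zero => simp
  | add x y _ _ hx hy => rw [add_mul]; exact Submodule.add_mem _ hx hy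
  | smul a x _ hx => rw [smul_mul_assoc]; exact Submodule.smul_mem _ a hx

/-- The `i`-th dimension subgroup `G ∩ (1 + Δ i)` defined by the N-series `N` with coefficients
in `R`, where `Δ i` is the `i`-th term of the filtration of `R[G]` induced by `N`. -/
noncomputable def dimensionSubgroup {G : Type*} [Group G] (N : NSeries G)
    (R : Type*) [CommRing R] (i : ℕ+) : Subgroup G where
  carrier := {g | MonoidAlgebra.of R G g - 1 ∈ N.groupRingFiltration R i}
  one_mem' := by simp [MonoidAlgebra.one_def]
  mul_mem' := by
    intro g h hg hh
    have e : MonoidAlgebra.of R G (g * h) - 1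
        = (MonoidAlgebra.of R G g - 1) * MonoidAlgebra.of R G h
          + (MonoidAlgebra.of R G h - 1) := by
      rw [map_mul, sub_mul, one_mul, sub_add_sub_cancel]
    rw [Set.mem_ofPred_eq, e]
    exact Submodule.add_mem _ (N.mul_of_mem_groupRingFiltration R i h hg) hh
  inv_mem' := by
    intro g hg
    have e : MonoidAlgebra.of R G g⁻¹ - 1
        = -((MonoidAlgebra.of R G g - 1) * MonoidAlgebra.of R G g⁻¹) := by
      rw [sub_mul, one_mul, ← map_mul, mul_inv_cancel, map_one, neg_sub]
    rw [Set.mem_ofPred_eq, e]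
    exact Submodule.neg_mem _ (N.mul_of_mem_groupRingFiltration R i g⁻¹ hg)

end NSeries

/-- The isolator `√H = {g : g ^ m ∈ H for some m ≥ 1}` of a subgroup `H` of `G`. -/
def Subgroup.isolator {G : Type*} [Group G] (H : Subgroup G) : Set G :=
  {g | ∃ m : ℕ, 1 ≤ m ∧ g ^ m ∈ H}

/-! One inclusion is a bootstrap: if `g ^ m ∈ N_i` and `z = g - 1` has degree `n` with `1 ≤ n < i`,
then `g ^ m - 1 = m z + z² s` has degree `n + 1`, as does `z² s`; dividing by `m` improves the
degree of `z`.

For the other inclusion, let `g - 1` have degree `i`. By induction on `w ≤ i`, some power `g ^ m`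
lies in `N_w`, with `g ^ m - 1` of degree `i` already in the group ring of `N_w` filtered by the
restricted series. If `w < i`, a character of the abelian group `N_w / N_{w+1}` with values in `F`
gives a representation on dual numbers with `ε` in degree `w`, which kills degree `i`; so no such
character detects `g ^ m`, and a further power lies in `N_{w+1}`
(`exists_pow_mem_term_succ_of_term_eq_top`).

The crux is to pass from `F[N_w]` to `F[N_{w+1}]` without losing degree (`mem_filtOf_term_succ`).
Only finitely many elements of `N_w` matter, so it suffices to treat `H = K⟨x⟩` with `N_{w+1} ≤ K ≤
H ≤ N_w`. Let `A` be `F[K]` modulo degree `i`. Left multiplication of `K` on `A` extends to `H` by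
letting `x` act as `v ↦ σ(v) y`, where `σ` is conjugation by `x` and `y` is an `m`-th root of `x ^ m
∈ K`, which exists because `x ^ m - 1` is nilpotent in `A` and the characteristic is zero
(`exists_filtered_extension`). This action respects degrees, so an element of degree `i` in `F[H]`
kills `1 ∈ A`. -/

/-- A decreasing multiplicative filtration of an algebra by submodules, indexed by `ℕ`. -/
structure IsAlgebraFiltration {F B : Type*} [CommRing F] [Ring B] [Algebra F B]
    (A : ℕ → Submodule F B) : Prop where
  antitone : Antitone A
  one_mem : 1 ∈ A 0
  mul_mem : ∀ {m n : ℕ} {a b : B}, a ∈ A m → b ∈ A n → a * b ∈ A (m + n)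

theorem IsAlgebraFiltration.map {F B C : Type*} [CommRing F] [Ring B] [Algebra F B] [Ring C]
    [Algebra F C] {A : ℕ → Submodule F B} (hA : IsAlgebraFiltration A) (f : B →ₐ[F] C) :
    IsAlgebraFiltration fun n => (A n).map f.toLinearMap where
  antitone _ _ h := Submodule.map_mono (hA.antitone h)
  one_mem := ⟨1, hA.one_mem, map_one f⟩
  mul_mem := by
    rintro m n _ _ ⟨x, hx, rfl⟩ ⟨y, hy, rfl⟩
    exact ⟨x * y, hA.mul_mem hx hy, map_mul f x y⟩

/-! ### The group ring filtration and its universal property. -/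

namespace NSeries

variable {G : Type*} [Group G] (N : NSeries G) (F : Type*) [CommRing F]

/-- The filtration `groupRingFiltration`, extended to the index `0`. -/
noncomputable def filt (n : ℕ) : Submodule F (MonoidAlgebra F G) :=
  Submodule.span F {x | ∃ l : List (ℕ+ × G), (∀ p ∈ l, p.2 ∈ N.term p.1) ∧
    n ≤ (l.map fun p => (p.1 : ℕ)).sum ∧
    x = (l.map fun p => MonoidAlgebra.of F G p.2 - 1).prod}

theorem isAlgebraFiltration_filt : IsAlgebraFiltration (N.filt F) where
  antitone m n h := by
    refine Submodule.span_mono ?_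
    rintro x ⟨l, hl, hn, rfl⟩
    exact ⟨l, hl, h.trans hn, rfl⟩
  one_mem := Submodule.subset_span ⟨[], by simp, by simp, by simp⟩
  mul_mem {m n a b} ha hb := by
    have h : N.filt F m * N.filt F n ≤ N.filt F (m + n) := by
      rw [filt, filt, Submodule.span_mul_span]
      refine Submodule.span_mono ?_
      rintro _ ⟨_, ⟨l, hl, hm, rfl⟩, _, ⟨l', hl', hn, rfl⟩, rfl⟩
      refine ⟨l ++ l', ?_, ?_, ?_⟩
      · intro p hp
        rcases List.mem_append.1 hp with hp | hp
        · exact hl p hp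
        · exact hl' p hp
      · rw [List.map_append, List.sum_append]
        exact add_le_add hm hn
      · rw [List.map_append, List.prod_append]
    exact h (Submodule.mul_mem_mul ha hb)

variable {F} in
theorem of_sub_one_mem_filt {k : ℕ+} {g : G} (hg : g ∈ N.term k) :
    MonoidAlgebra.of F G g - 1 ∈ N.filt F k :=
  Submodule.subset_span ⟨[(k, g)], by simpa using hg, by simp, by simp⟩

/-- `N_1 = G` puts each `g - 1` in degree 1, and the empty product supplies `1` in degree 0. Hence
every term of the filtration is a two-sided ideal. -/
theorem filt_zero : N.filt F 0 = ⊤ := by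
  rw [eq_top_iff]
  intro x _
  induction x using MonoidAlgebra.induction_on with
  | of g =>
    have h1 := N.of_sub_one_mem_filt (F := F) (k := 1) (g := g) (by simp [N.term_one])
    have h2 := (N.isAlgebraFiltration_filt F).antitone (Nat.zero_le _) h1
    simpa using add_mem h2 (N.isAlgebraFiltration_filt F).one_mem
  | add x y hx hy => exact add_mem (hx trivial) (hy trivial)
  | smul r x hx => exact Submodule.smul_mem _ r (hx trivial)

variable {F} in
theorem list_prod_mem {B : Type*} [Ring B] [Algebra F B] {A : ℕ → Submodule F B}
    (hA : IsAlgebraFiltration A) (l : List (ℕ+ × B)) (hl : ∀ p ∈ l, p.2 ∈ A p.1) :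
    (l.map Prod.snd).prod ∈ A (l.map fun p => (p.1 : ℕ)).sum := by
  induction l with
  | nil => simpa using hA.one_mem
  | cons p l ih =>
    simp only [List.map_cons, List.prod_cons, List.sum_cons]
    exact hA.mul_mem (hl p (by simp)) (ih fun q hq => hl q (by simp [hq]))

variable {N F} in
/-- A representation compatible with a filtration maps the `n`-th term of the group ring
filtration into the `n`-th term of the filtration. -/
theorem lift_mem_of_mem_filt {B : Type*} [Ring B] [Algebra F B] {A : ℕ → Submodule F B}
    (hA : IsAlgebraFiltration A) (ρ : G →* B)
    (hρ : ∀ (k : ℕ+) (g : G), g ∈ N.term k → ρ g - 1 ∈ A k) {n : ℕ} {x : MonoidAlgebra F G}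
    (hx : x ∈ N.filt F n) : MonoidAlgebra.lift F B G ρ x ∈ A n := by
  induction hx using Submodule.span_induction with
  | mem x hx =>
    obtain ⟨l, hl, hn, rfl⟩ := hx
    have h := list_prod_mem hA (l.map fun p => (p.1, ρ p.2 - 1)) (by
      intro p hp
      obtain ⟨q, hq, rfl⟩ := List.mem_map.1 hp
      exact hρ _ _ (hl q hq))
    rw [List.map_map, List.map_map] at h
    have e : MonoidAlgebra.lift F B G ρ (l.map fun p => MonoidAlgebra.of F G p.2 - 1).prod
        = (l.map (Prod.snd ∘ fun p => (p.1, ρ p.2 - 1))).prod := by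
      rw [map_list_prod, List.map_map]
      congr 1
      refine List.map_congr_left fun p _ => ?_
      simp only [Function.comp_apply, map_sub, map_one, MonoidAlgebra.lift_of]
    rw [e]
    exact hA.antitone hn h
  | zero => simp
  | add x y _ _ hx hy => rw [map_add]; exact add_mem hx hy
  | smul a x _ hx => rw [map_smul]; exact Submodule.smul_mem _ a hx

/-! ### Restriction to subgroups. -/

/-- The N-series induced on a subgroup. -/
def restrict (H : Subgroup G) : NSeries H where
  term i := (N.term i).subgroupOf H
  term_one := by rw [N.term_one]; exact Subgroup.top_subgroupOf H
  antitone_term i j h := Subgroup.comap_mono (N.antitone_term h)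
  commutator_le i j := by
    rw [Subgroup.commutator_le]
    intro a ha b hb
    exact N.commutator_le i j (Subgroup.commutator_mem_commutator
      (Subgroup.mem_subgroupOf.1 ha) (Subgroup.mem_subgroupOf.1 hb))

theorem mem_restrict_term {H : Subgroup G} {i : ℕ+} {h : H} :
    h ∈ (N.restrict H).term i ↔ (h : G) ∈ N.term i := Iff.rfl

/-- The filtration of the group ring of a subgroup, mapped to the group ring of `G`. -/
noncomputable def filtOf (H : Subgroup G) (n : ℕ) : Submodule F (MonoidAlgebra F G) :=
  ((N.restrict H).filt F n).map (MonoidAlgebra.mapDomainAlgHom F F H.subtype).toLinearMap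

-- Injectivity of `F[H] → F[G]` allows passing between the intrinsic filtration of `F[H]` and its
-- image, so that different subgroups can be compared inside `F[G]`.
variable {F} in
theorem mem_filtOf_iff {H : Subgroup G} {n : ℕ} {g : G} (hg : g ∈ H) :
    MonoidAlgebra.of F G g - 1 ∈ N.filtOf F H n ↔
      MonoidAlgebra.of F H ⟨g, hg⟩ - 1 ∈ (N.restrict H).filt F n := by
  have e : MonoidAlgebra.of F G g - 1 = MonoidAlgebra.mapDomainAlgHom F F H.subtype
      (MonoidAlgebra.of F H ⟨g, hg⟩ - 1) := by
    rw [map_sub, map_one]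
    congr 1
    simp
  rw [e, filtOf]
  constructor
  · rintro ⟨x, hx, hxe⟩
    have := MonoidAlgebra.mapDomain_injective (R := F) H.subtype_injective
      (show MonoidAlgebra.mapDomain _ x = MonoidAlgebra.mapDomain _ _ from hxe)
    rwa [← this]
  · exact fun h => ⟨_, h, rfl⟩

theorem isAlgebraFiltration_filtOf (H : Subgroup G) : IsAlgebraFiltration (N.filtOf F H) :=
  ((N.restrict H).isAlgebraFiltration_filt F).map _

variable {F} in
theorem of_sub_one_mem_filtOf {H : Subgroup G} {k : ℕ+} {g : G} (hg : g ∈ N.term k) (hH : g ∈ H) :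
    MonoidAlgebra.of F G g - 1 ∈ N.filtOf F H k :=
  (N.mem_filtOf_iff hH).2 ((N.restrict H).of_sub_one_mem_filt hg)

theorem filtOf_top (n : ℕ) : N.filt F n ≤ N.filtOf F ⊤ n := by
  intro x hx
  have h := lift_mem_of_mem_filt (N.isAlgebraFiltration_filtOf F ⊤) (MonoidAlgebra.of F G)
    (fun k g hg => N.of_sub_one_mem_filtOf hg trivial) hx
  have e : MonoidAlgebra.lift F _ G (MonoidAlgebra.of F G) = AlgHom.id F _ := by
    ext
    simp
  rwa [e, AlgHom.id_apply] at h

theorem filtOf_mono {H K : Subgroup G} (h : H ≤ K) (n : ℕ) : N.filtOf F H n ≤ N.filtOf F K n := by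
  rintro _ ⟨x, hx, rfl⟩
  have := lift_mem_of_mem_filt (N.isAlgebraFiltration_filtOf F K)
    ((MonoidAlgebra.of F G).comp H.subtype)
    (fun k g hg => N.of_sub_one_mem_filtOf hg (h g.2)) hx
  convert this using 1
  change MonoidAlgebra.mapDomainAlgHom F F H.subtype x = _
  congr 1
  ext
  simp

/-- Membership in the filtration involves only finitely many group elements. -/
theorem exists_finset_mem_filtOf {H : Subgroup G} {n : ℕ} {x : MonoidAlgebra F G}
    (hx : x ∈ N.filtOf F H n) :
    ∃ S : Finset G, (∀ s ∈ S, s ∈ H) ∧ x ∈ N.filtOf F (Subgroup.closure (S : Set G)) n := by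
  classical
  obtain ⟨x, hx, rfl⟩ := hx
  induction hx using Submodule.span_induction with
  | mem x hx =>
    obtain ⟨l, hl, hn, rfl⟩ := hx
    refine ⟨(l.map fun p => (p.2 : G)).toFinset, ?_, ?_⟩
    · intro s hs
      obtain ⟨p, -, rfl⟩ := List.mem_map.1 (List.mem_toFinset.1 hs)
      exact p.2.2
    · set T := Subgroup.closure (((l.map fun p => (p.2 : G)).toFinset : Finset G) : Set G) with hT
      have h := list_prod_mem (N.isAlgebraFiltration_filtOf F T)
        (l.map fun p => (p.1, MonoidAlgebra.of F G p.2 - 1)) (by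
          intro p hp
          obtain ⟨q, hq, rfl⟩ := List.mem_map.1 hp
          refine N.of_sub_one_mem_filtOf (hl q hq) (Subgroup.subset_closure ?_)
          rw [Finset.mem_coe, List.mem_toFinset]
          exact List.mem_map.2 ⟨q, hq, rfl⟩)
      rw [List.map_map, List.map_map] at h
      have e : (MonoidAlgebra.mapDomainAlgHom F F H.subtype).toLinearMap
          (l.map fun p => MonoidAlgebra.of F H p.2 - 1).prod
          = (l.map (Prod.snd ∘ fun p => (p.1, MonoidAlgebra.of F G p.2 - 1))).prod := by
        rw [AlgHom.toLinearMap_apply, map_list_prod, List.map_map]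
        congr 1
        refine List.map_congr_left fun p _ => ?_
        simp only [Function.comp_apply, map_sub, map_one]
        simp
      rw [e]
      exact (N.isAlgebraFiltration_filtOf F T).antitone hn h
  | zero => exact ⟨∅, by simp, by simp⟩
  | add x y _ _ hx hy =>
    obtain ⟨S, hS, hx⟩ := hx
    obtain ⟨T, hT, hy⟩ := hy
    refine ⟨S ∪ T, ?_, ?_⟩
    · intro s hs
      rcases Finset.mem_union.1 hs with h | h
      · exact hS s h
      · exact hT s h
    · rw [map_add]
      exact add_mem (N.filtOf_mono F (Subgroup.closure_mono (by simp)) n hx)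
        (N.filtOf_mono F (Subgroup.closure_mono (by simp)) n hy)
  | smul a x _ hx =>
    obtain ⟨S, hS, hx⟩ := hx
    exact ⟨S, hS, by rw [map_smul]; exact Submodule.smul_mem _ a hx⟩

end NSeries

/-! ### Roots of unipotent elements. -/

/-- Truncated `m`-th root of `1 + X` over a field of characteristic zero. -/
theorem Polynomial.exists_root_one_add_X (F : Type*) [Field F] [CharZero F] {m : ℕ} (hm : m ≠ 0)
    (n : ℕ) : ∃ q : Polynomial F, Polynomial.X ^ n ∣ (1 + Polynomial.X * q) ^ m
      - (1 + Polynomial.X) := by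
  let _ : Algebra ℚ F := DivisionRing.toRatAlgebra
  set f : PowerSeries F := PowerSeries.binomialSeries F (1 / m : ℚ) with hf
  have hpow : ∀ k : ℕ, f ^ k = PowerSeries.binomialSeries F ((k : ℚ) * (1 / m)) := by
    intro k
    induction k with
    | zero => simp
    | succ k ih => rw [pow_succ, ih, Nat.cast_succ, add_mul, one_mul,
        PowerSeries.binomialSeries_add]
  have hfm : f ^ m = 1 + PowerSeries.X := by
    rw [hpow, mul_one_div_cancel (Nat.cast_ne_zero.2 hm)]
    simpa using PowerSeries.binomialSeries_nat (R := ℚ) (A := F) 1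
  -- Truncating at `n + 1` rather than `n` keeps the constant coefficient 1 even when `n = 0`.
  set p := PowerSeries.trunc (n + 1) f with hp
  have hp0 : p.coeff 0 = 1 := by
    rw [hp, PowerSeries.coeff_trunc, if_pos (Nat.succ_pos n),
      PowerSeries.coeff_zero_eq_constantCoeff_apply, hf, PowerSeries.binomialSeries_constantCoeff]
  obtain ⟨q, hq⟩ : Polynomial.X ∣ p - 1 := by
    rw [Polynomial.X_dvd_iff]
    simp [hp0]
  refine ⟨q, ?_⟩
  rw [← hq, add_sub_cancel, Polynomial.X_pow_dvd_iff]
  intro d hd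
  have h := PowerSeries.trunc_trunc_pow f (n + 1) m
  rw [← hp, hfm] at h
  have h2 := congrArg (fun r => r.coeff d) h
  simp only [PowerSeries.coeff_trunc, if_pos (Nat.lt_succ_of_lt hd)] at h2
  rw [← Polynomial.coe_pow, Polynomial.coeff_coe] at h2
  rw [Polynomial.coeff_sub, h2, map_add, Polynomial.coeff_add, PowerSeries.coeff_one,
    PowerSeries.coeff_X, Polynomial.coeff_one, Polynomial.coeff_X]
  simp [eq_comm]

/-- Unipotent elements in characteristic zero have `m`-th roots that are polynomials in them. -/
theorem exists_root_of_sub_one_nilpotent (F : Type*) [Field F] [CharZero F] {A : Type*} [Ring A]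
    [Algebra F A] {m : ℕ} (hm : m ≠ 0) {u : A} (hu : IsNilpotent (u - 1)) :
    ∃ q : Polynomial F, (1 + (u - 1) * Polynomial.aeval u q) ^ m = u := by
  obtain ⟨n, hn⟩ := hu
  obtain ⟨q, r, hr⟩ := Polynomial.exists_root_one_add_X F hm n
  refine ⟨q.comp (Polynomial.X - 1), ?_⟩
  have h := congrArg (Polynomial.aeval (u - 1)) hr
  simp only [map_sub, map_mul, map_pow, map_add, map_one, Polynomial.aeval_X, hn, zero_mul] at h
  rw [Polynomial.aeval_comp]
  simp only [map_sub, map_one, Polynomial.aeval_X]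
  rw [sub_eq_zero.1 h, add_sub_cancel]

/-! ### Cyclic extensions of groups. -/

/-- A homomorphism intertwining an automorphism with conjugation by `q` intertwines powers. -/
theorem MonoidHom.zpow_intertwine {K Q : Type*} [Group K] [Group Q] (f : K →* Q) (c : MulAut K)
    (q : Q) (h : ∀ k, f (c k) = q * f k * q⁻¹) (a : ℤ) (k : K) :
    f ((c ^ a) k) = q ^ a * f k * (q ^ a)⁻¹ := by
  have h' : ∀ k, f (c⁻¹ k) = q⁻¹ * f k * q := by
    intro k
    have := h (c⁻¹ k)
    rw [MulAut.apply_inv_self] at this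
    rw [this]
    group
  induction a with
  | zero => simp
  | succ n ih =>
    rw [add_comm, zpow_one_add, zpow_one_add, MulAut.mul_apply, h, ih]
    group
  | pred n ih =>
    rw [sub_eq_neg_add, zpow_add, zpow_add, zpow_neg_one, zpow_neg_one, MulAut.mul_apply, h', ih]
    group

/-- A homomorphism defined on a normal subgroup `K` extends to a cyclic extension `H = K⟨x⟩`,
given a compatible value at `x`. -/
theorem MonoidHom.exists_extension_of_cyclic {K H Q : Type*} [Group K] [Group H] [Group Q]
    (j : K →* H) (c : MulAut K) (x : H) (hc : ∀ k, j (c k) = x * j k * x⁻¹)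
    (hsurj : ∀ h, ∃ k, ∃ a : ℤ, h = j k * x ^ a)
    (f : K →* Q) (q : Q) (hq : ∀ k, f (c k) = q * f k * q⁻¹)
    (hker : ∀ (k : K) (a : ℤ), j k * x ^ a = 1 → f k * q ^ a = 1) :
    ∃ ρ : H →* Q, (∀ k, ρ (j k) = f k) ∧ ρ x = q := by
  let φ : Multiplicative ℤ →* MulAut K := zpowersHom _ c
  have hφ : ∀ a k, φ a k = (c ^ a.toAdd) k := fun a k => by simp [φ, zpowersHom_apply]
  -- `H` is a quotient of `K ⋊ ℤ` via `p`; the extension is obtained by factoring `r` through `p`,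
  -- and `hker` says that `ker p ≤ ker r`.
  let p : K ⋊[φ] Multiplicative ℤ →* H := SemidirectProduct.lift j (zpowersHom _ x) (by
    intro a
    ext k
    simpa [hφ, zpowersHom_apply, ← MulAut.conj_apply, -map_zpow, ← map_zpow MulAut.conj] using
      j.zpow_intertwine c x hc a.toAdd k)
  let r : K ⋊[φ] Multiplicative ℤ →* Q := SemidirectProduct.lift f (zpowersHom _ q) (by
    intro a
    ext k
    simpa [hφ, zpowersHom_apply, ← MulAut.conj_apply, -map_zpow, ← map_zpow MulAut.conj] using
      f.zpow_intertwine c q hq a.toAdd k)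
  have hp : ∀ k a, p ⟨k, Multiplicative.ofAdd a⟩ = j k * x ^ a := fun k a => by
    rw [SemidirectProduct.mk_eq_inl_mul_inr, map_mul]
    simp [p, zpowersHom_apply]
  have hr : ∀ k a, r ⟨k, Multiplicative.ofAdd a⟩ = f k * q ^ a := fun k a => by
    rw [SemidirectProduct.mk_eq_inl_mul_inr, map_mul]
    simp [r, zpowersHom_apply]
  have hps : Function.Surjective p := by
    intro h
    obtain ⟨k, a, rfl⟩ := hsurj h
    exact ⟨_, hp k a⟩
  have hle : p.ker ≤ r.ker := by
    rintro ⟨k, a⟩ ha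
    rw [MonoidHom.mem_ker] at ha ⊢
    exact (hr k a.toAdd).trans (hker k a.toAdd ((hp k a.toAdd).symm.trans ha))
  let ρ : H →* Q := MonoidHom.liftOfSurjective p hps ⟨r, hle⟩
  have hρ : ∀ s, ρ (p s) = r s := fun s =>
    MonoidHom.liftOfRightInverse_comp_apply p _ (Function.rightInverse_surjInv hps) ⟨r, hle⟩ s
  refine ⟨ρ, fun k => ?_, ?_⟩
  · have := hρ ⟨k, Multiplicative.ofAdd 0⟩
    rw [hp, hr] at this
    simpa using this
  · have := hρ ⟨1, Multiplicative.ofAdd 1⟩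
    rw [hp, hr] at this
    simpa using this

/-! ### Congruence subgroups and filtered endomorphisms. -/

namespace IsAlgebraFiltration

variable {F B : Type*} [CommRing F] [Ring B] [Algebra F B] {A : ℕ → Submodule F B}

theorem pow_mem (hA : IsAlgebraFiltration A) {n : ℕ} {a : B} (ha : a ∈ A n) (k : ℕ) :
    a ^ k ∈ A (k * n) := by
  induction k with
  | zero => simpa using hA.one_mem
  | succ k ih =>
    rw [pow_succ, Nat.succ_mul]
    exact hA.mul_mem ih ha

theorem mem_zero_of_sub_one_mem (hA : IsAlgebraFiltration A) {n : ℕ} {a : B} (ha : a - 1 ∈ A n) :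
    a ∈ A 0 := by
  simpa using add_mem (hA.antitone (Nat.zero_le n) ha) hA.one_mem

/-- The group of units congruent to `1` modulo the `n`-th term of a filtration. -/
def congruenceSubgroup (hA : IsAlgebraFiltration A) (n : ℕ) : Subgroup Bˣ where
  carrier := {b | (b : B) - 1 ∈ A n ∧ ((b⁻¹ : Bˣ) : B) - 1 ∈ A n}
  one_mem' := by simp
  mul_mem' := by
    have key : ∀ a b : B, a - 1 ∈ A n → b - 1 ∈ A n → a * b - 1 ∈ A n := by
      intro a b ha hb
      have e : a * b - 1 = (a - 1) * b + (b - 1) := by noncomm_ring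
      rw [e]
      exact add_mem (hA.mul_mem ha (hA.mem_zero_of_sub_one_mem hb)) hb
    intro a b ha hb
    refine ⟨?_, ?_⟩
    · rw [Units.val_mul]
      exact key _ _ ha.1 hb.1
    · rw [mul_inv_rev, Units.val_mul]
      exact key _ _ hb.2 ha.2
  inv_mem' := by
    intro a ha
    exact ⟨ha.2, by rw [inv_inv]; exact ha.1⟩

/-- Since `b⁻¹ - 1 = -b⁻¹ (b - 1)`, the inverse only has to be of degree 0. -/
theorem mem_congruenceSubgroup (hA : IsAlgebraFiltration A) {n : ℕ} {b : Bˣ}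
    (hb : (b : B) - 1 ∈ A n) (hb' : ((b⁻¹ : Bˣ) : B) ∈ A 0) : b ∈ hA.congruenceSubgroup n := by
  refine ⟨hb, ?_⟩
  have e : ((b⁻¹ : Bˣ) : B) - 1 = -(((b⁻¹ : Bˣ) : B) * ((b : B) - 1)) := by
    rw [mul_sub, Units.inv_mul, mul_one, neg_sub]
  rw [e]
  exact neg_mem (by simpa using hA.mul_mem hb' hb)

end IsAlgebraFiltration

/-- The endomorphisms raising the degree in a filtration by at least `n`. -/
def Submodule.endFiltration {F V : Type*} [CommRing F] [AddCommGroup V] [Module F V]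
    (A : ℕ → Submodule F V) (n : ℕ) : Submodule F (Module.End F V) where
  carrier := {T | ∀ k, ∀ v ∈ A k, T v ∈ A (k + n)}
  add_mem' hS hT k v hv := add_mem (hS k v hv) (hT k v hv)
  zero_mem' _ _ _ := zero_mem _
  smul_mem' a _ hT k v hv := Submodule.smul_mem _ a (hT k v hv)

theorem Submodule.isAlgebraFiltration_endFiltration {F V : Type*} [CommRing F] [AddCommGroup V]
    [Module F V] {A : ℕ → Submodule F V} (hA : Antitone A) :
    IsAlgebraFiltration (Submodule.endFiltration A) where
  antitone _ _ h _ hT k v hv := hA (Nat.add_le_add_left h k) (hT k v hv)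
  one_mem _ _ hv := hv
  mul_mem {m n S T} hS hT k v hv := by
    have := hS _ _ (hT k v hv)
    rwa [add_assoc, add_comm n m] at this

/-- The set of exponents `a` with `x ^ a` in a given subgroup consists of multiples of a natural
number in that set. -/
theorem Subgroup.exists_natCast_dvd_of_zpow_mem {H : Type*} [Group H] (S : Subgroup H) (x : H) :
    ∃ m : ℕ, x ^ m ∈ S ∧ ∀ a : ℤ, x ^ a ∈ S → ∃ b : ℤ, a = m * b := by
  let T : AddSubgroup ℤ :=
    { carrier := {a | x ^ a ∈ S}
      zero_mem' := by simp
      add_mem' := fun {a b} ha hb => by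
        have := S.mul_mem ha hb
        rwa [← zpow_add] at this
      neg_mem' := fun {a} ha => by
        have := S.inv_mem ha
        rwa [← zpow_neg] at this }
  obtain ⟨m, hm⟩ := Int.subgroup_cyclic T
  have hmT : m ∈ T := by rw [hm]; exact AddSubgroup.subset_closure rfl
  refine ⟨m.natAbs, ?_, ?_⟩
  · have h : (m.natAbs : ℤ) ∈ T := by
      rcases Int.natAbs_eq m with h | h
      · rwa [← h]
      · rw [← neg_eq_iff_eq_neg.2 h]; exact T.neg_mem hmT
    have : x ^ (m.natAbs : ℤ) ∈ S := h
    rwa [zpow_natCast] at this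
  · intro a ha
    have : a ∈ T := ha
    rw [hm, AddSubgroup.mem_closure_singleton] at this
    obtain ⟨b, rfl⟩ := this
    rw [smul_eq_mul, mul_comm]
    exact (Int.natAbs_dvd.2 (dvd_mul_right m b))

/-! ### Extending the left multiplication representation. -/

section Extension

variable {F : Type*} [Field F] [CharZero F] {A : Type*} [Ring A] [Algebra F A]
  {Af : ℕ → Submodule F A}

/-- Roots of unipotent elements of a nilpotently filtered algebra, fixed by the automorphisms
that fix the given element. -/
theorem exists_root_mem_filtration (hA : IsAlgebraFiltration Af) (hA0 : Af 0 = ⊤) {i w : ℕ}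
    (hAi : Af i = ⊥) (hw : 0 < w) {u : A} (hu : IsUnit u) (huw : u - 1 ∈ Af w) {m : ℕ}
    (hm : m = 0 → u = 1) (σ : A ≃ₐ[F] A) (hσ : σ u = u) :
    ∃ y : Aˣ, (y : A) ^ m = u ∧ σ y = y ∧ (y : A) - 1 ∈ Af w := by
  rcases eq_or_ne m 0 with rfl | hm0
  · exact ⟨1, by simp [hm rfl]⟩
  have hnil : IsNilpotent (u - 1) := by
    refine ⟨i, ?_⟩
    have := hA.antitone (Nat.le_mul_of_pos_right i hw) (hA.pow_mem huw i)
    rwa [hAi, Submodule.mem_bot] at this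
  obtain ⟨q, hq⟩ := exists_root_of_sub_one_nilpotent F hm0 hnil
  have hunit : IsUnit (1 + (u - 1) * Polynomial.aeval u q) := by
    rw [← isUnit_pow_iff hm0, hq]
    exact hu
  refine ⟨hunit.unit, hq, ?_, ?_⟩
  · rw [IsUnit.unit_spec, map_add, map_mul, map_sub, map_one, hσ, ← Polynomial.aeval_algHom_apply,
      hσ]
  · rw [IsUnit.unit_spec, add_sub_cancel_left]
    simpa using hA.mul_mem huw (show Polynomial.aeval u q ∈ Af 0 by rw [hA0]; trivial)

/-- The left multiplication representation attached to a homomorphism into an algebra. -/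
noncomputable def mulLeftHom (F : Type*) [CommRing F] {A : Type*} [Ring A] [Algebra F A]
    {K : Type*} [Group K] (ι : K →* A) : K →* (Module.End F A)ˣ :=
  ((Algebra.lmul F A : A →* Module.End F A).comp ι).toHomUnits

theorem mulLeftHom_apply (F : Type*) [CommRing F] {A : Type*} [Ring A] [Algebra F A]
    {K : Type*} [Group K] (ι : K →* A) (k : K) (v : A) :
    (mulLeftHom F ι k : Module.End F A) v = ι k * v := rfl

/-- The linear automorphism `v ↦ σ v * y` of an algebra. -/
noncomputable def AlgEquiv.twist {F : Type*} [CommRing F] {A : Type*} [Ring A] [Algebra F A]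
    (σ : A ≃ₐ[F] A) (y : Aˣ) : (Module.End F A)ˣ where
  val := LinearMap.mulRight F (y : A) ∘ₗ σ.toLinearMap
  inv := σ.symm.toLinearMap ∘ₗ LinearMap.mulRight F ((y⁻¹ : Aˣ) : A)
  val_inv := by ext v; simp
  inv_val := by ext v; simp

theorem AlgEquiv.twist_apply {F : Type*} [CommRing F] {A : Type*} [Ring A] [Algebra F A]
    (σ : A ≃ₐ[F] A) (y : Aˣ) (v : A) : (σ.twist y : Module.End F A) v = σ v * y := rfl

theorem AlgEquiv.twist_inv_apply {F : Type*} [CommRing F] {A : Type*} [Ring A] [Algebra F A]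
    (σ : A ≃ₐ[F] A) (y : Aˣ) (v : A) :
    (((σ.twist y)⁻¹ : (Module.End F A)ˣ) : Module.End F A) v
      = σ.symm (v * ((y⁻¹ : Aˣ) : A)) := rfl

/-- The left multiplication representation of a normal subgroup `K` on a nilpotently filtered
algebra extends, compatibly with the filtration, to a cyclic extension of `K`. -/
theorem exists_filtered_extension {H K : Type*} [Group H] [Group K] (N : NSeries H) {w : ℕ+}
    (hNw : N.term w = ⊤) {j : K →* H} (hj : Function.Injective j)
    (hNK : N.term (w + 1) ≤ j.range) (c : MulAut K) (x : H)
    (hc : ∀ k, j (c k) = x * j k * x⁻¹) (hsurj : ∀ h, ∃ k, ∃ a : ℤ, h = j k * x ^ a)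
    (hA : IsAlgebraFiltration Af) (hA0 : Af 0 = ⊤) {i : ℕ} (hAi : Af i = ⊥)
    (ι : K →* A) (hι : ∀ (l : ℕ+) (k : K), j k ∈ N.term l → ι k - 1 ∈ Af l)
    (hspan : Submodule.span F (Set.range ι) = ⊤)
    (σ : A ≃ₐ[F] A) (hσι : ∀ k, σ (ι k) = ι (c k))
    (hσ : ∀ n, ∀ v ∈ Af n, σ v - v ∈ Af (n + w)) (hσs : ∀ n, ∀ v ∈ Af n, σ.symm v ∈ Af n) :
    ∃ ρ : H →* (Module.End F A)ˣ, (∀ k, ρ (j k) = mulLeftHom F ι k) ∧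
      ∀ (l : ℕ+) (h : H), h ∈ N.term l →
        (ρ h : Module.End F A) - 1 ∈ Submodule.endFiltration Af l := by
  -- Here `x ^ m = k₀` generates `⟨x⟩ ∩ K`; `m = 0` is the case where no nonzero power of `x` lies
  -- in `K`, and then `k₀ = 1`.
  obtain ⟨m, ⟨k₀, hk₀⟩, hm⟩ := j.range.exists_natCast_dvd_of_zpow_mem x
  have hck₀ : c k₀ = k₀ := hj (by rw [hc, hk₀]; group)
  have hιw : ∀ k, ι k - 1 ∈ Af w := fun k => hι w k (by rw [hNw]; trivial)
  obtain ⟨y, hym, hσy, hyw⟩ := exists_root_mem_filtration hA hA0 hAi w.pos (u := ι k₀) (m := m)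
    ((Group.isUnit k₀).map ι) (hιw k₀) (by
      rintro rfl
      rw [pow_zero] at hk₀
      rw [hj (hk₀.trans (map_one j).symm), map_one]) σ (by rw [hσι, hck₀])
  -- Right multiplication by `y` commutes with left multiplications, so only `σ` contributes to the
  -- conjugation.
  have hX : ∀ k, mulLeftHom F ι (c k) = σ.twist y * mulLeftHom F ι k * (σ.twist y)⁻¹ := by
    intro k
    rw [eq_mul_inv_iff_mul_eq]
    ext v
    simp only [Units.val_mul, Module.End.mul_apply, mulLeftHom_apply, AlgEquiv.twist_apply,
      map_mul, hσι, mul_assoc]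
  have hXpow : ∀ (n : ℕ) (k : K),
      ((σ.twist y ^ n : (Module.End F A)ˣ) : Module.End F A) (ι k)
        = ι ((c ^ n) k) * (y : A) ^ n := by
    intro n k
    induction n with
    | zero => simp
    | succ n ih =>
      rw [pow_succ', pow_succ', Units.val_mul, Module.End.mul_apply, ih, AlgEquiv.twist_apply,
        map_mul, map_pow, hσι, hσy, MulAut.mul_apply, pow_succ, mul_assoc]
  -- As `σ y = y`, the `m`-th power sends `k` to `(k₀ k k₀⁻¹) y ^ m = k₀ k`.
  have hXm : σ.twist y ^ m = mulLeftHom F ι k₀ := by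
    apply Units.ext
    refine LinearMap.ext_on hspan ?_
    rintro _ ⟨k, rfl⟩
    rw [hXpow, mulLeftHom_apply, hym, ← map_mul, ← map_mul]
    congr 1
    apply hj
    have := j.zpow_intertwine c x hc m k
    rw [zpow_natCast, zpow_natCast, ← hk₀] at this
    rw [map_mul, this, map_mul]
    group
  obtain ⟨ρ, hρj, hρx⟩ := j.exists_extension_of_cyclic c x hc hsurj (mulLeftHom F ι) (σ.twist y) hX
    (by
      intro k a hka
      have hxa : x ^ a = j k⁻¹ := by rw [map_inv]; exact eq_inv_of_mul_eq_one_right hka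
      obtain ⟨b, rfl⟩ := hm a ⟨_, hxa.symm⟩
      have hk : k⁻¹ = k₀ ^ b := hj (by rw [← hxa, map_zpow, hk₀, zpow_mul, zpow_natCast])
      rw [zpow_mul, zpow_natCast, hXm, ← map_zpow, ← hk, ← map_mul, mul_inv_cancel, map_one])
  have hE := Submodule.isAlgebraFiltration_endFiltration hA.antitone
  have hmul : ∀ (l : ℕ) (k : K), ι k - 1 ∈ Af l →
      (mulLeftHom F ι k : Module.End F A) - 1 ∈ Submodule.endFiltration Af l := by
    intro l k hk n v hv
    rw [LinearMap.sub_apply, mulLeftHom_apply, Module.End.one_apply, ← sub_one_mul, add_comm]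
    exact hA.mul_mem hk hv
  have hXE : σ.twist y ∈ hE.congruenceSubgroup w := by
    refine hE.mem_congruenceSubgroup ?_ ?_
    · intro n v hv
      have e : ((σ.twist y : Module.End F A) - 1) v = (σ v - v) * y + v * (y - 1) := by
        rw [LinearMap.sub_apply, AlgEquiv.twist_apply, Module.End.one_apply]
        noncomm_ring
      rw [e]
      have hy0 : (y : A) ∈ Af 0 := by rw [hA0]; trivial
      exact add_mem (by simpa using hA.mul_mem (hσ n v hv) hy0) (hA.mul_mem hv hyw)
    · intro n v hv
      rw [AlgEquiv.twist_inv_apply]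
      have hy0 : ((y⁻¹ : Aˣ) : A) ∈ Af 0 := by rw [hA0]; trivial
      exact hσs _ _ (hA.mul_mem hv hy0)
  refine ⟨ρ, hρj, ?_⟩
  intro l h hh
  -- Above degree `w` the element lies in `K`, where the degree is that of left multiplication. Up
  -- to degree `w`, it is enough that all of `H` acts trivially modulo degree `w`.
  rcases lt_or_ge w l with hl | hl
  · obtain ⟨k, rfl⟩ := hNK (N.antitone_term (PNat.add_one_le_iff.2 hl) hh)
    rw [hρj]
    exact hmul _ _ (hι l k hh)
  · obtain ⟨k, a, rfl⟩ := hsurj h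
    have hk : mulLeftHom F ι k ∈ hE.congruenceSubgroup w := by
      refine ⟨hmul _ _ (hιw k), ?_⟩
      rw [← map_inv]
      exact hmul _ _ (hιw k⁻¹)
    rw [map_mul, map_zpow, hρj, hρx]
    exact hE.antitone hl (mul_mem hk (zpow_mem hXE a)).1

end Extension

/-! ### Descent from `N_w` to `N_{w+1}`. -/

/-- The elements of a filtration whose degree is raised by at least `w` under `σ - 1` form
a filtration. -/
theorem IsAlgebraFiltration.inf_comap_sub_one {F B : Type*} [CommRing F] [Ring B] [Algebra F B]
    {A : ℕ → Submodule F B} (hA : IsAlgebraFiltration A) (σ : B →ₐ[F] B) (w : ℕ) :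
    IsAlgebraFiltration fun n =>
      A n ⊓ (A (n + w)).comap (σ.toLinearMap - LinearMap.id) where
  antitone m n h := inf_le_inf (hA.antitone h)
    (Submodule.comap_mono (hA.antitone (Nat.add_le_add_right h w)))
  one_mem := ⟨hA.one_mem, by simp⟩
  mul_mem := by
    rintro m n a b ⟨ha, ha'⟩ ⟨hb, hb'⟩
    refine ⟨hA.mul_mem ha hb, ?_⟩
    rw [SetLike.mem_coe, Submodule.mem_comap, LinearMap.sub_apply, AlgHom.toLinearMap_apply,
      LinearMap.id_apply] at ha' hb' ⊢
    -- Twisted Leibniz rule; `σ b` is written `b + (σ b - b)` to show that it has degree `n`.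
    have e : σ (a * b) - a * b = (σ a - a) * (b + (σ b - b)) + a * (σ b - b) := by
      rw [map_mul]
      noncomm_ring
    rw [e]
    refine add_mem ?_ ?_
    · have := hA.mul_mem ha' (add_mem hb (hA.antitone (Nat.le_add_right n w) hb'))
      rwa [add_right_comm] at this
    · have := hA.mul_mem ha hb'
      rwa [← add_assoc] at this

namespace NSeries

variable {G : Type*} [Group G] (N : NSeries G)

theorem term_normal (i : ℕ+) : (N.term i).Normal := by
  refine ⟨fun n hn g => ?_⟩
  have h := N.commutator_le 1 i (Subgroup.commutator_mem_commutator
    (show g ∈ N.term 1 by rw [N.term_one]; trivial) hn)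
  have h' := mul_mem (N.antitone_term (PNat.lt_add_left i 1).le h) hn
  rwa [commutatorElement_def, inv_mul_cancel_right] at h'

/-- `[G, K] ≤ [N_1, N_w] ≤ N_{w+1} ≤ K`. -/
theorem normal_of_le_of_le {w : ℕ+} {K : Subgroup G} (h : N.term (w + 1) ≤ K) (h' : K ≤ N.term w) :
    K.Normal := by
  refine ⟨fun n hn g => ?_⟩
  have hc := N.commutator_le 1 w (Subgroup.commutator_mem_commutator
    (show g ∈ N.term 1 by rw [N.term_one]; trivial) (h' hn))
  rw [add_comm] at hc
  have := mul_mem (h hc) hn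
  rwa [commutatorElement_def, inv_mul_cancel_right] at this

variable (F : Type*) [Field F]

/-- The terms of the group ring filtration as ideals. -/
noncomputable def filtIdeal (n : ℕ) : Ideal (MonoidAlgebra F G) where
  carrier := {x | x ∈ N.filt F n}
  add_mem' ha hb := (N.filt F n).add_mem ha hb
  zero_mem' := (N.filt F n).zero_mem
  smul_mem' a x hx := by
    have ha : a ∈ N.filt F 0 := by rw [filt_zero]; trivial
    have h := (N.isAlgebraFiltration_filt F).mul_mem ha hx
    rw [zero_add] at h
    exact h

variable {F} in
theorem mem_filtIdeal {n : ℕ} {x : MonoidAlgebra F G} :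
    x ∈ N.filtIdeal F n ↔ x ∈ N.filt F n := Iff.rfl

instance (n : ℕ) : (N.filtIdeal F n).IsTwoSided := by
  refine ⟨fun {a} b ha => ?_⟩
  have hb : b ∈ N.filt F 0 := by rw [filt_zero]; trivial
  have h := (N.isAlgebraFiltration_filt F).mul_mem (N.mem_filtIdeal.1 ha) hb
  rw [add_zero] at h
  exact N.mem_filtIdeal.2 h

-- On generators, `σ(g - 1) - (g - 1) = (c(g) g⁻¹ - 1) g` has the required degree. Elements with
-- this property form a filtration, so the universal property covers the rest.
variable {N F} in
theorem domCongr_sub_mem_filt {c : MulAut G} {w : ℕ+}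
    (hc : ∀ (l : ℕ+) (g : G), g ∈ N.term l → c g * g⁻¹ ∈ N.term (l + w)) {n : ℕ}
    {v : MonoidAlgebra F G} (hv : v ∈ N.filt F n) :
    MonoidAlgebra.domCongr F F c v - v ∈ N.filt F (n + w) := by
  have hA := N.isAlgebraFiltration_filt F
  let σ : MonoidAlgebra F G →ₐ[F] MonoidAlgebra F G := MonoidAlgebra.domCongr F F c
  have hσ : ∀ g, σ (MonoidAlgebra.of F G g) = MonoidAlgebra.of F G (c g) := by
    intro g
    simp [σ]
  have key : ∀ (k : ℕ+) (g : G), g ∈ N.term k → MonoidAlgebra.of F G g - 1 ∈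
      N.filt F k ⊓ (N.filt F (k + w)).comap (σ.toLinearMap - LinearMap.id) := by
    intro k g hg
    refine Submodule.mem_inf.2 ⟨N.of_sub_one_mem_filt hg, ?_⟩
    have e : σ (MonoidAlgebra.of F G g - 1) - (MonoidAlgebra.of F G g - 1)
        = (MonoidAlgebra.of F G (c g * g⁻¹) - 1) * MonoidAlgebra.of F G g := by
      rw [sub_mul, ← map_mul, inv_mul_cancel_right, one_mul, map_sub, map_one, hσ,
        sub_sub_sub_cancel_right]
    rw [Submodule.mem_comap, LinearMap.sub_apply, AlgHom.toLinearMap_apply, LinearMap.id_apply, e]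
    have h0 : MonoidAlgebra.of F G g ∈ N.filt F 0 := by rw [filt_zero]; trivial
    simpa using hA.mul_mem (N.of_sub_one_mem_filt (F := F) (hc k g hg)) h0
  have h := lift_mem_of_mem_filt (hA.inf_comap_sub_one σ w) (MonoidAlgebra.of F G) key hv
  have e : MonoidAlgebra.lift F _ G (MonoidAlgebra.of F G) = AlgHom.id F _ := by
    ext
    simp
  rw [e] at h
  exact h.2

variable {F} [CharZero F]

/-- One cyclic step of the descent: `g - 1` acts on `F[K]` modulo degree `i` through the extended
representation, raising degrees by `i`. Its value at `1` is the class of `g - 1`, which therefore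
vanishes. -/
theorem mem_filtOf_of_mem_filtOf_sup_zpowers {w : ℕ+} {K : Subgroup G}
    (hwK : N.term (w + 1) ≤ K) (hKw : K ≤ N.term w) {x : G} (hx : x ∈ N.term w) {i : ℕ} {g : G}
    (hg : g ∈ K) (hgi : MonoidAlgebra.of F G g - 1 ∈ N.filtOf F (K ⊔ Subgroup.zpowers x) i) :
    MonoidAlgebra.of F G g - 1 ∈ N.filtOf F K i := by
  have hKn := N.normal_of_le_of_le hwK hKw
  set H := K ⊔ Subgroup.zpowers x with hH
  have hKH : K ≤ H := le_sup_left
  have hxH : x ∈ H := (le_sup_right : _ ≤ H) (Subgroup.mem_zpowers x)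
  have hHw : H ≤ N.term w := sup_le hKw ((Subgroup.zpowers_le).2 hx)
  let c : MulAut K := MulAut.conjNormal x
  have hc : ∀ (l : ℕ+) (k : K), k ∈ (N.restrict K).term l →
      c k * k⁻¹ ∈ (N.restrict K).term (l + w) := by
    intro l k hk
    rw [mem_restrict_term] at hk ⊢
    have := N.commutator_le w l (Subgroup.commutator_mem_commutator hx hk)
    rw [add_comm] at this
    simpa [c, commutatorElement_def] using this
  have hcs : ∀ (l : ℕ+) (k : K), k ∈ (N.restrict K).term l → c⁻¹ k ∈ (N.restrict K).term l := by
    intro l k hk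
    rw [mem_restrict_term] at hk ⊢
    have := (N.term_normal l).conj_mem _ hk x⁻¹
    simpa [c, ← map_inv] using this
  let M := N.restrict K
  let I := M.filtIdeal F i
  have hfilt := M.isAlgebraFiltration_filt F
  let σ := MonoidAlgebra.domCongr F F c
  have hσsub : ∀ n, ∀ v ∈ M.filt F n, σ v - v ∈ M.filt F (n + w) :=
    fun n v hv => domCongr_sub_mem_filt hc hv
  have hσmem : ∀ n, ∀ v ∈ M.filt F n, σ v ∈ M.filt F n := by
    intro n v hv
    simpa using add_mem (hfilt.antitone (Nat.le_add_right n w) (hσsub n v hv)) hv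
  have hσsymm : ∀ n, ∀ v ∈ M.filt F n, σ.symm v ∈ M.filt F n := by
    intro n v hv
    have h := lift_mem_of_mem_filt hfilt ((MonoidAlgebra.of F K).comp (c⁻¹ : MulAut K).toMonoidHom)
      (fun l k hk => M.of_sub_one_mem_filt (hcs l k hk)) hv
    convert h using 1
    change σ.symm.toAlgHom v = _
    congr 1
    ext k
    simp [σ]
  have hmap : I = I.map (σ : MonoidAlgebra F K →+* MonoidAlgebra F K) := by
    apply le_antisymm
    · intro v hv
      have := Ideal.mem_map_of_mem (σ : MonoidAlgebra F K →+* MonoidAlgebra F K)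
        (show σ.symm v ∈ I from hσsymm i v hv)
      simpa using this
    · rw [Ideal.map_le_iff_le_comap]
      exact fun v hv => hσmem i v hv
  let σA : (MonoidAlgebra F K ⧸ I) ≃ₐ[F] MonoidAlgebra F K ⧸ I := Ideal.quotientEquivAlg I I σ hmap
  let mk : MonoidAlgebra F K →ₐ[F] MonoidAlgebra F K ⧸ I := Ideal.Quotient.mkₐ F I
  have hmk : Function.Surjective mk := Ideal.Quotient.mkₐ_surjective F I
  have hσA : ∀ v, σA (mk v) = mk (σ v) := fun v => Ideal.quotientEquivAlg_mk I σ hmap v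
  have hσAs : ∀ v, σA.symm (mk v) = mk (σ.symm v) := fun v => by
    rw [AlgEquiv.symm_apply_eq, hσA, AlgEquiv.apply_symm_apply]
  let ι : K →* MonoidAlgebra F K ⧸ I := (mk : _ →* _).comp (MonoidAlgebra.of F K)
  have hker : ∀ v, mk v = 0 ↔ v ∈ M.filt F i := fun v => Ideal.Quotient.eq_zero_iff_mem
  obtain ⟨ρ, hρK, hρ⟩ := exists_filtered_extension (F := F) (N.restrict H) (w := w)
    (Subgroup.subgroupOf_eq_top.2 hHw) (Subgroup.inclusion_injective hKH)
    (by
      intro h hh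
      exact ⟨⟨h, hwK hh⟩, rfl⟩)
    c ⟨x, hxH⟩ (fun k => Subtype.ext (by simp [c]))
    (by
      rintro ⟨h, hh⟩
      obtain ⟨k, hk, z, ⟨a, rfl⟩, rfl⟩ := Subgroup.mem_sup_of_normal_left.1 hh
      exact ⟨⟨k, hk⟩, a, Subtype.ext (by simp)⟩)
    (hfilt.map mk)
    (by
      rw [filt_zero, Submodule.map_top]
      exact LinearMap.range_eq_top.2 hmk)
    (i := i)
    (by
      rw [eq_bot_iff]
      rintro _ ⟨v, hv, rfl⟩
      exact (hker v).2 hv)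
    ι
    (by
      intro l k hk
      exact ⟨_, M.of_sub_one_mem_filt (k := l) (g := k) hk, by simp [ι]⟩)
    (by
      rw [eq_top_iff]
      intro v _
      obtain ⟨v, rfl⟩ := hmk v
      induction v using MonoidAlgebra.induction_on with
      | of k => exact Submodule.subset_span ⟨k, rfl⟩
      | add a b ha hb => rw [map_add]; exact add_mem (ha trivial) (hb trivial)
      | smul r a ha => rw [map_smul]; exact Submodule.smul_mem _ r (ha trivial))
    σA
    (by
      intro k
      refine (hσA _).trans (congrArg mk ?_)
      simp [σ])
    (by
      rintro n _ ⟨v, hv, rfl⟩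
      exact ⟨_, hσsub n v hv, by simp [hσA]⟩)
    (by
      rintro n _ ⟨v, hv, rfl⟩
      exact ⟨_, hσsymm n v hv, (hσAs v).symm⟩)
  rw [mem_filtOf_iff _ (hKH hg)] at hgi
  have hE := Submodule.isAlgebraFiltration_endFiltration (hfilt.map mk).antitone
  have hE := lift_mem_of_mem_filt hE ((Units.coeHom _).comp ρ) hρ hgi
  rw [map_sub, map_one, MonoidAlgebra.lift_of, MonoidHom.comp_apply, Units.coeHom_apply,
    show (⟨g, hKH hg⟩ : H) = Subgroup.inclusion hKH ⟨g, hg⟩ from rfl, hρK] at hE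
  have h := hE 0 1 (hfilt.map mk).one_mem
  rw [LinearMap.sub_apply, mulLeftHom_apply, Module.End.one_apply, mul_one, zero_add] at h
  obtain ⟨v, hv, hve⟩ := h
  rw [mem_filtOf_iff _ hg, ← hker, map_sub, map_one]
  exact hve.symm.trans ((hker v).2 hv)

/-- A witness for the degree uses finitely many elements of `N_w`; these are removed one at a time
by the cyclic step. -/
theorem mem_filtOf_term_succ {w : ℕ+} {i : ℕ} {g : G} (hg : g ∈ N.term (w + 1))
    (hgi : MonoidAlgebra.of F G g - 1 ∈ N.filtOf F (N.term w) i) :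
    MonoidAlgebra.of F G g - 1 ∈ N.filtOf F (N.term (w + 1)) i := by
  classical
  have key : ∀ S : Finset G, (∀ s ∈ S, s ∈ N.term w) →
      MonoidAlgebra.of F G g - 1
        ∈ N.filtOf F (N.term (w + 1) ⊔ Subgroup.closure (S : Set G)) i →
      MonoidAlgebra.of F G g - 1 ∈ N.filtOf F (N.term (w + 1)) i := by
    intro S
    induction S using Finset.induction_on with
    | empty => simp
    | insert x S _ ih =>
      intro hS h
      have hSw : ∀ s ∈ S, s ∈ N.term w := fun s hs => hS s (Finset.mem_insert_of_mem hs)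
      refine ih hSw (N.mem_filtOf_of_mem_filtOf_sup_zpowers (w := w) (x := x) le_sup_left
        (sup_le (N.antitone_term (PNat.lt_add_right w 1).le) ((Subgroup.closure_le _).2 hSw))
        (hS x (Finset.mem_insert_self x S)) (Subgroup.mem_sup_left hg) ?_)
      rwa [Finset.coe_insert, Set.insert_eq, Subgroup.closure_union, ← Subgroup.zpowers_eq_closure,
        sup_comm (Subgroup.zpowers x), ← sup_assoc] at h
  obtain ⟨S, hS, h⟩ := N.exists_finset_mem_filtOf F hgi
  exact key S hS (N.filtOf_mono F le_sup_right i h)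

end NSeries

/-! ### Characters and dual numbers. -/

theorem one_add_pow_eq {B : Type*} [Ring B] (z : B) (m : ℕ) :
    ∃ s, (1 + z) ^ m = 1 + m • z + z * z * s := by
  induction m with
  | zero => exact ⟨0, by simp⟩
  | succ m ih =>
    obtain ⟨s, hs⟩ := ih
    refine ⟨m • 1 + s + s * z, ?_⟩
    rw [pow_succ, hs, succ_nsmul]
    simp only [mul_add, add_mul, mul_one, one_mul, smul_mul_assoc, mul_smul_comm, mul_assoc]
    abel

/-- An element of infinite order in an abelian group is detected by a character with values in
a field of characteristic zero. -/
theorem exists_addMonoidHom_eq_one (F : Type*) [Field F] [CharZero F] {Q : Type*} [AddCommGroup Q]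
    {q : Q} (hq : ∀ m : ℕ, 1 ≤ m → m • q ≠ 0) : ∃ φ : Q →+ F, φ q = 1 := by
  have hinj : Function.Injective (LinearMap.toSpanSingleton ℤ Q q) := by
    rw [injective_iff_map_eq_zero]
    intro a ha
    by_contra h
    refine hq a.natAbs (Int.natAbs_pos.2 h) ?_
    rw [LinearMap.toSpanSingleton_apply] at ha
    rw [← natCast_zsmul]
    rcases Int.natAbs_eq a with h | h
    · rw [← h, ha]
    · rw [← neg_eq_iff_eq_neg.2 h, neg_smul, ha, neg_zero]
  -- In characteristic zero `F` is divisible, hence injective over `ℤ`, so `q ↦ 1` extends from the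
  -- infinite cyclic group generated by `q`.
  obtain ⟨φ, hφ⟩ := (Module.Baer.of_divisible F).extension_property _ hinj
    (LinearMap.toSpanSingleton ℤ F 1)
  refine ⟨φ.toAddMonoidHom, ?_⟩
  have := LinearMap.congr_fun hφ 1
  simpa using this

/-- The representation `h ↦ 1 + φ h ε` on dual numbers attached to an additive character. -/
noncomputable def dualNumberHom {H F : Type*} [Group H] [Field F] (φ : H →* Multiplicative F) :
    H →* DualNumber F where
  toFun h := 1 + TrivSqZeroExt.inr (φ h).toAdd
  map_one' := by simp
  map_mul' a b := by
    ext <;> simp [add_comm]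

/-- The filtration of the dual numbers in which `ε` has degree `w`. -/
def dualNumberFiltration (F : Type*) [Field F] (w n : ℕ) : Submodule F (DualNumber F) where
  carrier := {b | (0 < n → b.fst = 0) ∧ (w < n → b.snd = 0)}
  add_mem' := by
    rintro a b ⟨ha, ha'⟩ ⟨hb, hb'⟩
    exact ⟨fun h => by simp [ha h, hb h], fun h => by simp [ha' h, hb' h]⟩
  zero_mem' := by simp
  smul_mem' := by
    rintro r a ⟨ha, ha'⟩
    exact ⟨fun h => by simp [ha h], fun h => by simp [ha' h]⟩

theorem isAlgebraFiltration_dualNumberFiltration (F : Type*) [Field F] (w : ℕ) :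
    IsAlgebraFiltration (dualNumberFiltration F w) where
  antitone _ _ h _ hb := ⟨fun h' => hb.1 (h'.trans_le h), fun h' => hb.2 (h'.trans_le h)⟩
  one_mem := ⟨fun h => absurd h (lt_irrefl _), fun h => absurd h (Nat.not_lt_zero _)⟩
  mul_mem := by
    rintro m n a b ⟨ha, ha'⟩ ⟨hb, hb'⟩
    refine ⟨fun h => ?_, fun h => ?_⟩
    · rcases Nat.eq_zero_or_pos m with rfl | hm
      · simp [hb (by simpa using h)]
      · simp [ha hm]
    · rw [TrivSqZeroExt.snd_mul]
      rcases Nat.eq_zero_or_pos m with rfl | hm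
      · rw [zero_add] at h
        simp [hb (by omega), hb' h]
      rcases Nat.eq_zero_or_pos n with rfl | hn
      · rw [add_zero] at h
        simp [ha hm, ha' h]
      · simp [ha hm, hb hn]

/-! ### The two inclusions. -/

namespace NSeries

variable {G : Type*} [Group G] (N : NSeries G) {F : Type*} [Field F]

theorem pow_sub_one_mem_filtOf {H : Subgroup G} {i : ℕ} {g : G}
    (hg : MonoidAlgebra.of F G g - 1 ∈ N.filtOf F H i) (m : ℕ) :
    MonoidAlgebra.of F G (g ^ m) - 1 ∈ N.filtOf F H i := by
  have hA := N.isAlgebraFiltration_filtOf F H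
  induction m with
  | zero => rw [pow_zero, map_one, sub_self]; exact zero_mem _
  | succ m ih =>
    have e : MonoidAlgebra.of F G (g ^ (m + 1)) - 1
        = (MonoidAlgebra.of F G (g ^ m) - 1) * MonoidAlgebra.of F G g
          + (MonoidAlgebra.of F G g - 1) := by
      rw [pow_succ, map_mul]
      noncomm_ring
    rw [e]
    exact add_mem (hA.mul_mem (n := 0) ih (hA.mem_zero_of_sub_one_mem hg)) hg

variable [CharZero F]

theorem exists_pow_mem_term_succ_of_term_eq_top {w : ℕ+} (hw : N.term w = ⊤) {i : ℕ}
    (hwi : (w : ℕ) < i) {g : G} (hg : MonoidAlgebra.of F G g - 1 ∈ N.filt F i) :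
    ∃ m : ℕ, 1 ≤ m ∧ g ^ m ∈ N.term (w + 1) := by
  by_contra! hcon
  have := N.term_normal (w + 1)
  let _ : CommGroup (G ⧸ N.term (w + 1)) :=
    { mul_comm := by
        rintro ⟨a⟩ ⟨b⟩
        refine QuotientGroup.eq.2 ?_
        have h := N.commutator_le w w (Subgroup.commutator_mem_commutator
          (show b⁻¹ ∈ N.term w by rw [hw]; trivial) (show a⁻¹ ∈ N.term w by rw [hw]; trivial))
        rw [commutatorElement_def, inv_inv, inv_inv] at h
        rw [mul_inv_rev, ← mul_assoc]
        exact N.antitone_term (add_le_add_right one_le w) h }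
  obtain ⟨φ, hφ⟩ := exists_addMonoidHom_eq_one F
    (q := Additive.ofMul (g : G ⧸ N.term (w + 1))) (by
      intro m hm h
      rw [← ofMul_pow, ofMul_eq_zero, ← QuotientGroup.mk_pow, QuotientGroup.eq_one_iff] at h
      exact hcon m hm h)
  let ψ : G →* Multiplicative F := (AddMonoidHom.toMultiplicativeRight φ).comp (QuotientGroup.mk' _)
  have hψ : ∀ h, (ψ h).toAdd = φ (Additive.ofMul (h : G ⧸ N.term (w + 1))) := fun _ => rfl
  have h := lift_mem_of_mem_filt (isAlgebraFiltration_dualNumberFiltration F w) (dualNumberHom ψ) (by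
    intro k h hk
    have e : dualNumberHom ψ h - 1 = TrivSqZeroExt.inr (ψ h).toAdd := add_sub_cancel_left _ _
    rw [e]
    refine ⟨fun _ => TrivSqZeroExt.fst_inr _ _, fun hwk => ?_⟩
    rw [TrivSqZeroExt.snd_inr, hψ, (QuotientGroup.eq_one_iff h).2
      (N.antitone_term (PNat.add_one_le_iff.2 hwk) hk), ofMul_one, map_zero]) hg
  have e : MonoidAlgebra.lift F _ G (dualNumberHom ψ) (MonoidAlgebra.of F G g - 1)
      = TrivSqZeroExt.inr 1 := by
    rw [map_sub, map_one, MonoidAlgebra.lift_of]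
    refine (add_sub_cancel_left _ _).trans ?_
    rw [hψ, hφ]
  rw [e] at h
  -- The image of `g - 1` is `ε`, of degree `w`, yet it must have degree `i > w`.
  exact one_ne_zero (h.2 hwi)

theorem isolator_subset_dimensionSubgroup (i : ℕ+) :
    (N.term i).isolator ⊆ (N.dimensionSubgroup F i : Set G) := by
  rintro g ⟨m, hm, hgm⟩
  have hA := N.isAlgebraFiltration_filt F
  have key : ∀ n : ℕ, 1 ≤ n → n ≤ i → MonoidAlgebra.of F G g - 1 ∈ N.filt F n := by
    intro n hn
    induction n, hn using Nat.le_induction with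
    | base => exact fun _ => N.of_sub_one_mem_filt (k := 1) (by rw [N.term_one]; trivial)
    | succ n hn ih =>
      intro hni
      have hz := ih (Nat.le_of_succ_le hni)
      set z := MonoidAlgebra.of F G g - 1 with hzdef
      obtain ⟨s, hs⟩ := one_add_pow_eq z m
      have h1 := hA.antitone hni (N.of_sub_one_mem_filt (F := F) hgm)
      rw [map_pow, ← add_sub_cancel 1 (MonoidAlgebra.of F G g), ← hzdef, hs, add_assoc,
        add_sub_cancel_left] at h1
      -- `z²` has degree `2n ≥ n + 1` because `n ≥ 1`.
      have h2 : z * z * s ∈ N.filt F (n + 1) :=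
        hA.antitone (by omega) (hA.mul_mem (hA.mul_mem hz hz)
          (show s ∈ N.filt F 0 by rw [filt_zero]; trivial))
      have h3 : m • z ∈ N.filt F (n + 1) := by simpa using sub_mem h1 h2
      rw [← Nat.cast_smul_eq_nsmul F] at h3
      exact (Submodule.smul_mem_iff _ (Nat.cast_ne_zero.2 (by omega))).1 h3
  exact key i i.pos le_rfl

theorem dimensionSubgroup_subset_isolator (i : ℕ+) :
    (N.dimensionSubgroup F i : Set G) ⊆ (N.term i).isolator := by
  intro g hg
  -- The degree is measured in `F[N_w]`, so that the character argument applies to the restricted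
  -- series, whose `w`-th term is the whole group.
  have key : ∀ w : ℕ+, w ≤ i → ∃ m : ℕ, 1 ≤ m ∧ g ^ m ∈ N.term w ∧
      MonoidAlgebra.of F G (g ^ m) - 1 ∈ N.filtOf F (N.term w) i := by
    intro w
    induction w using PNat.recOn with
    | one =>
      intro _
      refine ⟨1, le_rfl, by rw [N.term_one]; trivial, ?_⟩
      rw [N.term_one, pow_one]
      exact N.filtOf_top F i hg
    | succ w ih =>
      intro hwi
      obtain ⟨m, hm, hgm, hf⟩ := ih ((PNat.lt_add_right w 1).le.trans hwi)
      obtain ⟨m', hm', hgm'⟩ := (N.restrict (N.term w)).exists_pow_mem_term_succ_of_term_eq_top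
        (Subgroup.subgroupOf_self _) (PNat.add_one_le_iff.1 hwi) ((N.mem_filtOf_iff hgm).1 hf)
      have hmem : g ^ (m * m') ∈ N.term (w + 1) := by
        rw [pow_mul]
        exact hgm'
      refine ⟨m * m', Nat.mul_pos hm hm', hmem, N.mem_filtOf_term_succ hmem ?_⟩
      rw [pow_mul]
      exact N.pow_sub_one_mem_filtOf hf m'
  obtain ⟨m, hm, hgm, -⟩ := key i le_rfl
  exact ⟨m, hm, hgm⟩

end NSeries

theorem mainTheorem4 {G : Type*} [Group G] (N : NSeries G)
    (F : Type*) [Field F] [CharZero F] (i : ℕ+) :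
    (N.dimensionSubgroup F i : Set G) = (N.term i).isolator :=
  (N.dimensionSubgroup_subset_isolator i).antisymm (N.isolator_subset_dimensionSubgroup i)
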